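/- Let $\lambda$ denote the security parameter and let $n,\ell:\mathbb N\to\mathbb N$ satisfy $n(\lambda)=\omega(\log\lambda)$ (for instance $n(\lambda)\ge\lambda$) and $\ell(\lambda)=\omega(\lambda/\log\lambda)$. Let $\mu_n$ be the Haar probability measure on the unitary group of $n$ qubits. For every $\lambda$ let $\{G_k^U\}_{k\in\{0,1\}^\lambda}$ be a set of oracle algorithms such that for every $k$ there are $n(\lambda)$-qubit unitaries $A_k,B_k$ (for example, but not necessarily, efficiently implementable ones) with $G_k^U=B_k\,U\,A_k$ for every $n(\lambda)$-qubit unitary $U$; that is, $G_k$ makes a single call to the oracle $U$. **Security notion.** In the inverseless quantum Haar random oracle model, a two-oracle adversary has oracle access (without inverses) to a challenge oracle $W$ and to the common oracle $U$, both acting on $n(\lambda)$ qubits. It is computationally unbounded: it has any number of ancillary qubits, starts in $|0\rangle$, alternates arbitrary unitaries with queries to one of the two oracles, and ends with a two-outcome projective measurement. The family $\{G_k^U\}$ is an *$\ell$-query secure pseudorandom unitary* if for every family of adversaries $\mathcal A_\lambda$ making at most $\ell(\lambda)$ queries to the challenge oracle and at most polynomially many (in $\lambda$) queries to the common oracle there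 is a negligible function $\varepsilon$ such that for all $\lambda$ $$\Bigl|\Pr_{k\leftarrow\{0,1\}^\lambda,\;U\leftarrow\mu_{n(\lambda)}}\bigl[1\leftarrow\mathcal A_\lambda^{G_k^U,\,U}\bigr]-\Pr_{U,V\leftarrow\mu_{n(\lambda)}}\bigl[1\leftarrow\mathcal A_\lambda^{V,\,U}\bigr]\Bigr|\le\varepsilon(\lambda),$$ where $U$ and $V$ are independent. An adversary is *non-adaptive* if it prepares a state, makes all its queries to both oracles in parallel on separate registers of that state, and then performs a two-outcome projective measurement. **Theorem.** Under these assumptions $\{G_k^U\}_{k\in\{0,1\}^\lambda}$ is not an $\ell$-query secure pseudorandom unitary. It is not even $\ell$-query secure against non-adaptive adversaries. -/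

import Mathlib

open scoped Kronecker Matrix

noncomputable section

namespace HaarPRU

/-- Labels of the computational basis of `n` qubits; also the set of `n`-bit strings. -/
abbrev Qubits (n : ℕ) : Type := Fin n → Bool

/-- The group `U(2^n)` of unitary operators on `n` qubits. -/
abbrev UnitaryOp (n : ℕ) : Type := Matrix.unitaryGroup (Qubits n) ℂ

/-! ### The Haar probability measure on `U(2^n)` -/

instance instCompactSpaceUnitaryOp (n : ℕ) : CompactSpace (UnitaryOp n) := by
  refine isCompact_iff_compactSpace.mp (?_ : IsCompact ((Matrix.unitaryGroup (Qubits n) ℂ :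
    Submonoid _) : Set (Matrix (Qubits n) (Qubits n) ℂ)))
  have hc : IsClosed ((Matrix.unitaryGroup (Qubits n) ℂ : Submonoid _) :
      Set (Matrix (Qubits n) (Qubits n) ℂ)) := isClosed_unitary
  have hK : IsCompact (Set.univ.pi (fun _ : Qubits n => Set.univ.pi
      (fun _ : Qubits n => Metric.closedBall (0 : ℂ) 1))) :=
    isCompact_univ_pi fun _ => isCompact_univ_pi fun _ => isCompact_closedBall _ _
  refine hK.of_isClosed_subset hc ?_
  intro M hM i _ j _
  simpa using entry_norm_bound_of_unitary hM i j

instance instMeasurableSpaceUnitaryOp (n : ℕ) : MeasurableSpace (UnitaryOp n) :=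
  borel (UnitaryOp n)

instance instBorelSpaceUnitaryOp (n : ℕ) : BorelSpace (UnitaryOp n) := ⟨rfl⟩

/-- The Haar measure `μ_n` on the unitary group of `n` qubits, of total mass one. -/
def haarUnitary (n : ℕ) : MeasureTheory.Measure (UnitaryOp n) :=
  MeasureTheory.Measure.haarMeasure ⊤

instance instIsHaarMeasureHaarUnitary (n : ℕ) : (haarUnitary n).IsHaarMeasure := by
  unfold haarUnitary; infer_instance

instance instIsProbabilityMeasureHaarUnitary (n : ℕ) :
    MeasureTheory.IsProbabilityMeasure (haarUnitary n) :=
  ⟨by simpa [haarUnitary] using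
    MeasureTheory.Measure.haarMeasure_self (K₀ := (⊤ : TopologicalSpace.PositiveCompacts
      (UnitaryOp n)))⟩

/-! ### Distinguishing a keyed oracle construction from an independent Haar unitary -/

/-- A nonnegative function of the security parameter that tends to zero faster than every
inverse polynomial. -/
def Negligible (ε : ℕ → ℝ) : Prop :=
  (∀ lam, 0 ≤ ε lam) ∧
    Asymptotics.SuperpolynomialDecay Filter.atTop (fun lam : ℕ => (lam : ℝ)) ε

/-- A set of oracle algorithms with keys of `lam` bits: for each key and each unitary oracle `U`
on `n lam` qubits, the unitary `G_k^U` on `n lam` qubits that the algorithm implements. -/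
abbrev OracleConstruction (n : ℕ → ℕ) : Type :=
  ∀ lam : ℕ, Qubits lam → UnitaryOp (n lam) → UnitaryOp (n lam)

/-- For a two-oracle experiment which outputs `1` with probability `acc W U` when its first
(challenge) oracle is `W` and its second (common) oracle is `U`, the distance
`|Pr_{k, U}[acc G_k^U U] - Pr_{U, V}[acc V U]|`, with `k` a uniform `lam`-bit key and `U`, `V`
independent Haar unitaries. -/
def advantage {n : ℕ} (lam : ℕ) (G : Qubits lam → UnitaryOp n → UnitaryOp n)
    (acc : UnitaryOp n → UnitaryOp n → ℝ) : ℝ :=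
  |(∑ k : Qubits lam, ∫ U, acc (G k U) U ∂(haarUnitary n)) / 2 ^ lam
    - ∫ U, ∫ V, acc V U ∂(haarUnitary n) ∂(haarUnitary n)|

/-- The two oracles available in the security experiment. -/
inductive OracleName where
  /-- The challenge oracle: the construction, or an independent Haar unitary. -/
  | challenge
  /-- The common Haar random oracle. -/
  | haar
  deriving DecidableEq

/-- An adaptive two-oracle adversary, computationally unbounded, without access to inverses.
It has an `n`-qubit query register and an `anc`-qubit ancillary register. It is given by a list of
steps, each a unitary on both registers followed by one query, made on the query register to the
named oracle, and by a final two-outcome projective measurement. -/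
structure Adversary (n : ℕ) where
  /-- Number of ancillary qubits. -/
  anc : ℕ
  /-- The steps, first step at the head of the list. -/
  steps : List (Matrix.unitaryGroup (Qubits n × Qubits anc) ℂ × OracleName)
  /-- The projection of the outcome `1` of the final measurement. -/
  meas : Matrix (Qubits n × Qubits anc) (Qubits n × Qubits anc) ℂ
  isStarProjection_meas : IsStarProjection meas

namespace Adversary

variable {n : ℕ}

/-- Number of queries made to the given oracle. -/
def queries (𝒜 : Adversary n) (o : OracleName) : ℕ :=
  𝒜.steps.countP fun s => s.2 = o

/-- The final state `∏ᵢ (O⁽ⁱ⁾ ⊗ 1) A⁽ⁱ⁾ |0⟩` of the adversary. -/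
def view (𝒜 : Adversary n) (W U : UnitaryOp n) : Qubits n × Qubits 𝒜.anc → ℂ :=
  𝒜.steps.foldl
    (fun ψ s =>
      ((match s.2 with
          | .challenge => (W : Matrix (Qubits n) (Qubits n) ℂ)
          | .haar => (U : Matrix (Qubits n) (Qubits n) ℂ)) ⊗ₖ
        (1 : Matrix (Qubits 𝒜.anc) (Qubits 𝒜.anc) ℂ)) *ᵥ
      ((s.1 : Matrix (Qubits n × Qubits 𝒜.anc) (Qubits n × Qubits 𝒜.anc) ℂ) *ᵥ ψ))
    (Pi.single (fun _ => false, fun _ => false) 1)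

/-- The probability that the adversary outputs `1`. -/
def acceptProb (𝒜 : Adversary n) (W U : UnitaryOp n) : ℝ :=
  ∑ x, ‖(𝒜.meas *ᵥ 𝒜.view W U) x‖ ^ 2

end Adversary

/-- `ℓ`-query security as a pseudorandom unitary in the inverseless quantum Haar random oracle
model: every adversary that makes at most `ℓ` queries to the challenge oracle and polynomially
many queries to the common Haar oracle has negligible advantage. -/
def IsQuerySecurePRU (n ℓ : ℕ → ℕ) (G : OracleConstruction n) : Prop :=
  ∀ 𝒜 : ∀ lam, Adversary (n lam),
    (∀ lam, (𝒜 lam).queries .challenge ≤ ℓ lam) →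
    (∃ p : Polynomial ℕ, ∀ lam, (𝒜 lam).queries .haar ≤ p.eval lam) →
    ∃ ε, Negligible ε ∧ ∀ lam, advantage lam (G lam) (𝒜 lam).acceptProb ≤ ε lam

/-! ### Non-adaptive adversaries -/

/-- The `c`-fold tensor power of an operator on `n` qubits. -/
def tensorPow {n : ℕ} (c : ℕ) (M : Matrix (Qubits n) (Qubits n) ℂ) :
    Matrix (Fin c → Qubits n) (Fin c → Qubits n) ℂ :=
  Matrix.of fun x y => ∏ i, M (x i) (y i)

/-- A non-adaptive two-oracle adversary: it prepares a state, makes all its queries to both oracles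
in parallel on separate registers, and performs a two-outcome projective measurement on
everything. -/
structure NonadaptiveAdversary (n : ℕ) where
  /-- Number of queries to the challenge oracle. -/
  numChallenge : ℕ
  /-- Number of queries to the common Haar oracle. -/
  numHaar : ℕ
  /-- Number of ancillary qubits. -/
  anc : ℕ
  /-- The state that is prepared before the queries. -/
  init : ((Fin numChallenge → Qubits n) × (Fin numHaar → Qubits n)) × Qubits anc → ℂ
  norm_init : ∑ x, ‖init x‖ ^ 2 = 1
  /-- The projection of the outcome `1` of the final measurement. -/
  meas : Matrix (((Fin numChallenge → Qubits n) × (Fin numHaar → Qubits n)) × Qubits anc)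
    (((Fin numChallenge → Qubits n) × (Fin numHaar → Qubits n)) × Qubits anc) ℂ
  isStarProjection_meas : IsStarProjection meas

/-- The probability that the non-adaptive adversary outputs `1`. -/
def NonadaptiveAdversary.acceptProb {n : ℕ} (𝒜 : NonadaptiveAdversary n) (W U : UnitaryOp n) : ℝ :=
  ∑ x, ‖(𝒜.meas *ᵥ
    (((tensorPow 𝒜.numChallenge (W : Matrix (Qubits n) (Qubits n) ℂ) ⊗ₖ
        tensorPow 𝒜.numHaar (U : Matrix (Qubits n) (Qubits n) ℂ)) ⊗ₖ
      (1 : Matrix (Qubits 𝒜.anc) (Qubits 𝒜.anc) ℂ)) *ᵥ 𝒜.init)) x‖ ^ 2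

/-- `ℓ`-query security as in `IsQuerySecurePRU`, against non-adaptive adversaries only. -/
def IsNonadaptivelyQuerySecurePRU (n ℓ : ℕ → ℕ) (G : OracleConstruction n) : Prop :=
  ∀ 𝒜 : ∀ lam, NonadaptiveAdversary (n lam),
    (∀ lam, (𝒜 lam).numChallenge ≤ ℓ lam) →
    (∃ p : Polynomial ℕ, ∀ lam, (𝒜 lam).numHaar ≤ p.eval lam) →
    ∃ ε, Negligible ε ∧ ∀ lam, advantage lam (G lam) (𝒜 lam).acceptProb ≤ ε lam

end HaarPRU

end

/-! The attack applies the `t` challenge and `p` common queries to halves of maximally entangled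
states. The result is a product of Choi states, so overlaps are products of normalized traces. If
the challenge is `B * U * A`, the result lies in the span `K_k` of the states obtained from the
pairs `(B * Z * A, Z)` as `Z` varies. Up to fixed local unitaries this is a span of powers
`Z^{⊗(t+p)}`, which cannot tell the registers apart.

If the challenge is an independent `V`, the two groups of registers hold different unitaries. A
vector of `K_k` has the same overlap with each of the `(t+p).choose t` states obtained by changing
which registers hold the first one. These states are nearly orthogonal, so the squared projection to
`K_k` is about one over the binomial coefficient (`norm_starProjection_sq_le_of_exchangeable`,
`norm_starProjection_sandwichSpan_sq_le`). The error `(1 + r)^(t+p)`, with `r` a normalized trace,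
is averaged over `V` by a sub-Gaussian bound (`integral_one_add_trace_pow_le`).

One measurement serves all keys: `exists_detector` cuts the spectrum of the sum of the projections
to the `K_k` at `1/2`. It accepts each `K_k` with probability at least `1/2`; its false acceptance
is at most of order `2^lam / (t+p).choose t`. With `t = min ℓ lam` and `p = lam^3 + 1` the binomial
coefficient is at least `lam^(2t) ≥ 4^lam`, while `2^n ≥ lam^9` controls the error. Adaptive
insecurity follows by making the parallel queries one at a time (`exists_adaptive_simulation`). -/

noncomputable section

namespace HaarPRU

/-! ### The trace of a Haar random unitary -/

/-- The diagonal unitary with entries `±1` prescribed by a Boolean vector. -/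
def signUnitary {n : ℕ} (ε : Qubits n → Bool) : UnitaryOp n :=
  ⟨Matrix.diagonal fun i => if ε i then 1 else -1, by
    rw [Matrix.mem_unitaryGroup_iff, Matrix.star_eq_conjTranspose, Matrix.diagonal_conjTranspose,
      Matrix.diagonal_mul_diagonal, ← Matrix.diagonal_one]
    congr 1
    ext i
    by_cases h : ε i <;> simp [h]⟩

/-- Independence of the signs factors the sum into hyperbolic cosines, and `cosh x ≤ exp (x² / 2)`:
the sub-Gaussian bound for Rademacher sums. -/
lemma sum_exp_signs_le {ι : Type*} [Fintype ι] [DecidableEq ι] (a : ι → ℝ) :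
    ∑ ε : ι → Bool, Real.exp (∑ i, (if ε i then 1 else -1) * a i) ≤
      2 ^ Fintype.card ι * Real.exp ((∑ i, a i ^ 2) / 2) := by
  have h1 : ∑ ε : ι → Bool, Real.exp (∑ i, (if ε i then 1 else -1) * a i) =
      ∏ i, (2 * Real.cosh (a i)) := by
    simp_rw [Real.exp_sum]
    rw [← Fintype.prod_sum fun (i : ι) (b : Bool) => Real.exp ((if b then 1 else -1) * a i)]
    refine Finset.prod_congr rfl fun i _ => ?_
    rw [Fintype.sum_bool, Real.cosh_eq]
    simp only [if_true, Bool.false_eq_true, if_false]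
    ring_nf
  rw [h1, Finset.prod_mul_distrib, Finset.prod_const, Finset.card_univ, Finset.sum_div,
    Real.exp_sum]
  gcongr with i
  exact Real.cosh_le_exp_half_sq _

lemma exp_mul_abs_le (s x : ℝ) : Real.exp (s * |x|) ≤ Real.exp (s * x) + Real.exp (-s * x) := by
  rcases abs_cases x with ⟨h, _⟩ | ⟨h, _⟩ <;> rw [h]
  · linarith [Real.exp_pos (-s * x)]
  · have : s * -x = -s * x := by ring
    rw [this]; linarith [Real.exp_pos (s * x)]

lemma exp_mul_norm_le {s : ℝ} (hs : 0 ≤ s) (z : ℂ) :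
    Real.exp (s * ‖z‖) ≤
      (Real.exp (2 * s * z.re) + Real.exp (-(2 * s) * z.re) +
        (Real.exp (2 * s * z.im) + Real.exp (-(2 * s) * z.im))) / 2 := by
  have h1 : s * ‖z‖ ≤ s * |z.re| + s * |z.im| := by
    rw [← mul_add]; exact mul_le_mul_of_nonneg_left (Complex.norm_le_abs_re_add_abs_im z) hs
  have h2 : Real.exp (s * |z.re|) ^ 2 = Real.exp (2 * s * |z.re|) := by
    rw [← Real.exp_nat_mul]; push_cast; ring_nf
  have h3 : Real.exp (s * |z.im|) ^ 2 = Real.exp (2 * s * |z.im|) := by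
    rw [← Real.exp_nat_mul]; push_cast; ring_nf
  have h4 := exp_mul_abs_le (2 * s) z.re
  have h5 := exp_mul_abs_le (2 * s) z.im
  have h6 := Real.exp_le_exp.2 h1
  rw [Real.exp_add] at h6
  -- Arithmetic-geometric mean inequality, which decouples the real and imaginary parts at the price
  -- of doubling `s`.
  nlinarith [sq_nonneg (Real.exp (s * |z.re|) - Real.exp (s * |z.im|))]

/-- The real Rademacher bound is used four times, for the two signs of `2 * s` and for real and
imaginary parts. The four terms, halved, give the factor `2`. -/
lemma sum_exp_norm_signs_le {ι : Type*} [Fintype ι] [DecidableEq ι] {s : ℝ} (hs : 0 ≤ s)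
    (a : ι → ℂ) (ha : ∀ i, ‖a i‖ ≤ 1) :
    ∑ ε : ι → Bool, Real.exp (s * ‖∑ i, (if ε i then 1 else -1) * a i‖) ≤
      2 ^ Fintype.card ι * (2 * Real.exp (2 * s ^ 2 * Fintype.card ι)) := by
  have key : ∀ (c : ℝ) (b : ι → ℝ), c ^ 2 = 4 * s ^ 2 → (∀ i, |b i| ≤ 1) →
      ∑ ε : ι → Bool, Real.exp (c * ∑ i, (if ε i then 1 else -1) * b i) ≤
        2 ^ Fintype.card ι * Real.exp (2 * s ^ 2 * Fintype.card ι) := by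
    intro c b hc hb
    have h := sum_exp_signs_le fun i => c * b i
    have e : ∀ ε : ι → Bool, c * ∑ i, (if ε i then 1 else -1) * b i =
        ∑ i, (if ε i then 1 else -1) * (c * b i) := by
      intro ε
      rw [Finset.mul_sum]
      exact Finset.sum_congr rfl fun i _ => by ring
    simp_rw [e]
    refine h.trans ?_
    gcongr
    have : ∑ i, (c * b i) ^ 2 ≤ ∑ _i : ι, 4 * s ^ 2 := by
      refine Finset.sum_le_sum fun i _ => ?_
      rw [mul_pow, hc]
      exact mul_le_of_le_one_right (by positivity) ((sq_le_one_iff_abs_le_one _).2 (hb i))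
    rw [Finset.sum_const, Finset.card_univ, nsmul_eq_mul] at this
    linarith
  have hre : ∀ ε : ι → Bool, (∑ i, (if ε i then 1 else -1) * a i : ℂ).re =
      ∑ i, (if ε i then 1 else -1) * (a i).re := by
    intro ε
    rw [Complex.re_sum]
    exact Finset.sum_congr rfl fun i _ => by split_ifs <;> simp
  have him : ∀ ε : ι → Bool, (∑ i, (if ε i then 1 else -1) * a i : ℂ).im =
      ∑ i, (if ε i then 1 else -1) * (a i).im := by
    intro ε
    rw [Complex.im_sum]
    exact Finset.sum_congr rfl fun i _ => by split_ifs <;> simp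
  have hb1 : ∀ i, |(a i).re| ≤ 1 := fun i => (Complex.abs_re_le_norm _).trans (ha i)
  have hb2 : ∀ i, |(a i).im| ≤ 1 := fun i => (Complex.abs_im_le_norm _).trans (ha i)
  have k1 := key (2 * s) _ (by ring) hb1
  have k2 := key (-(2 * s)) _ (by ring) hb1
  have k3 := key (2 * s) _ (by ring) hb2
  have k4 := key (-(2 * s)) _ (by ring) hb2
  refine (Finset.sum_le_sum fun ε _ => exp_mul_norm_le hs _).trans ?_
  rw [← Finset.sum_div, Finset.sum_add_distrib, Finset.sum_add_distrib, Finset.sum_add_distrib]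
  simp_rw [hre, him]
  linarith

lemma continuous_trace_unitaryOp {n : ℕ} (X : Matrix (Qubits n) (Qubits n) ℂ) :
    Continuous fun V : UnitaryOp n => (X * (V : Matrix (Qubits n) (Qubits n) ℂ)).trace :=
  (continuous_const.mul continuous_subtype_val).matrix_trace

lemma integrable_of_continuous {n : ℕ} {f : UnitaryOp n → ℝ} (hf : Continuous f) :
    MeasureTheory.Integrable f (haarUnitary n) :=
  hf.integrable_of_hasCompactSupport (HasCompactSupport.of_compactSpace f)

/-- The moment generating function of `|tr V|` for a Haar random unitary `V`. -/
lemma integral_exp_norm_trace_le (n : ℕ) {s : ℝ} (hs : 0 ≤ s) :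
    ∫ V, Real.exp (s * ‖(V : Matrix (Qubits n) (Qubits n) ℂ).trace‖) ∂(haarUnitary n) ≤
      2 * Real.exp (2 * s ^ 2 * 2 ^ n) := by
  set f : UnitaryOp n → ℝ :=
    fun V => Real.exp (s * ‖(V : Matrix (Qubits n) (Qubits n) ℂ).trace‖) with hf
  have hfc : Continuous f := by
    have := continuous_trace_unitaryOp (n := n) 1
    simp only [one_mul] at this
    exact Real.continuous_exp.comp (continuous_const.mul this.norm)
  have hcard : Fintype.card (Qubits n) = 2 ^ n := by simp
  -- Haar invariance allows averaging over random signs on the rows, which turns the trace into a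
  -- Rademacher sum of diagonal entries of modulus at most one.
  have hinv : ∀ ε : Qubits n → Bool,
      ∫ V, f (signUnitary ε * V) ∂(haarUnitary n) = ∫ V, f V ∂(haarUnitary n) :=
    fun ε => MeasureTheory.integral_mul_left_eq_self f (signUnitary ε)
  have hint : ∀ ε : Qubits n → Bool,
      MeasureTheory.Integrable (fun V => f (signUnitary ε * V)) (haarUnitary n) :=
    fun ε => integrable_of_continuous (hfc.comp (continuous_const.mul continuous_id))
  have hsum : ∫ V, ∑ ε : Qubits n → Bool, f (signUnitary ε * V) ∂(haarUnitary n) =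
      2 ^ (2 ^ n) * ∫ V, f V ∂(haarUnitary n) := by
    rw [MeasureTheory.integral_finsetSum _ fun ε _ => hint ε]
    simp_rw [hinv]
    simp
  have hle : ∫ V, ∑ ε : Qubits n → Bool, f (signUnitary ε * V) ∂(haarUnitary n) ≤
      ∫ _V, (2 : ℝ) ^ (2 ^ n) * (2 * Real.exp (2 * s ^ 2 * 2 ^ n)) ∂(haarUnitary n) := by
    refine MeasureTheory.integral_mono (MeasureTheory.integrable_finsetSum _ fun ε _ => hint ε)
      (MeasureTheory.integrable_const _) fun V => ?_
    have h := sum_exp_norm_signs_le hs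
      (fun i => (V : Matrix (Qubits n) (Qubits n) ℂ) i i)
      fun i => entry_norm_bound_of_unitary V.2 i i
    rw [hcard] at h
    push_cast at h
    refine le_trans (le_of_eq ?_) h
    refine Finset.sum_congr rfl fun ε _ => ?_
    simp [hf, signUnitary, Matrix.trace, Matrix.diagonal_mul]
  rw [hsum, MeasureTheory.integral_const] at hle
  simp only [MeasureTheory.probReal_univ, one_smul] at hle
  exact le_of_mul_le_mul_left hle (by positivity)

/-- A Haar random unitary is nearly orthogonal to any fixed one. -/
lemma integral_one_add_trace_pow_le (n m : ℕ) (X : UnitaryOp n) :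
    ∫ V, (1 + ‖((X⁻¹ : UnitaryOp n) * (V : UnitaryOp n) : UnitaryOp n).1.trace / 2 ^ n‖) ^ m
      ∂(haarUnitary n) ≤ 2 * Real.exp (2 * m ^ 2 / 2 ^ n) := by
  have h0 := MeasureTheory.integral_mul_left_eq_self (μ := haarUnitary n)
    (fun V : UnitaryOp n => (1 + ‖V.1.trace / 2 ^ n‖) ^ m) X⁻¹
  refine h0.trans_le ?_
  -- From `1 + x ≤ exp x`, the `m`-th power is at most `exp (s * ‖tr V‖)` with `s = m / 2 ^ n`.
  refine le_trans ?_ ((integral_exp_norm_trace_le n (s := m / 2 ^ n) (by positivity)).trans_eq ?_)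
  · have hc := continuous_trace_unitaryOp (n := n) 1
    simp only [one_mul] at hc
    refine MeasureTheory.integral_mono (integrable_of_continuous ?_) (integrable_of_continuous ?_)
      fun V => ?_
    · exact (continuous_const.add (hc.div_const _).norm).pow m
    · exact Real.continuous_exp.comp (continuous_const.mul hc.norm)
    · have e : (m : ℝ) / 2 ^ n * ‖V.1.trace‖ = m * ‖V.1.trace / 2 ^ n‖ := by
        rw [norm_div]; simp; ring
      simp only [e, Real.exp_nat_mul]
      gcongr
      rw [add_comm]
      exact Real.add_one_le_exp _
  · congr 2
    field_simp

/-! ### Detecting membership in a union of subspaces -/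

section Detector

variable {E : Type*} [NormedAddCommGroup E] [InnerProductSpace ℂ E] [FiniteDimensional ℂ E]

lemma isSymmetric_sum_starProjection {κ : Type*} [Fintype κ] (K : κ → Submodule ℂ E) :
    (∑ k, ((K k).starProjection : E →ₗ[ℂ] E)).IsSymmetric := by
  intro x y
  simp only [LinearMap.sum_apply, sum_inner, inner_sum]
  exact Finset.sum_congr rfl fun k _ => Submodule.inner_starProjection_left_eq_right _ x y

lemma inner_sum_starProjection_self {κ : Type*} [Fintype κ] (K : κ → Submodule ℂ E) (x : E) :
    (inner ℂ x ((∑ k, ((K k).starProjection : E →ₗ[ℂ] E)) x)).re =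
      ∑ k, ‖(K k).starProjection x‖ ^ 2 := by
  simp only [LinearMap.sum_apply, inner_sum, Complex.re_sum]
  refine Finset.sum_congr rfl fun k _ => ?_
  have h := (K k).inner_starProjection_left_eq_right x ((K k).starProjection x)
  have h2 : (K k).starProjection ((K k).starProjection x) = (K k).starProjection x :=
    Submodule.starProjection_eq_self_iff.2 (Submodule.starProjection_apply_mem _ _)
  rw [h2] at h
  show (inner ℂ x ((K k).starProjection x)).re = _
  rw [← h, inner_self_eq_norm_sq_to_K]
  norm_cast

/-- A projection that accepts every vector of every given subspace with probability at least one
half, and accepts any vector at most as often as allowed by its projections to the subspaces. -/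
theorem exists_detector {κ : Type*} [Fintype κ] (K : κ → Submodule ℂ E) :
    ∃ P : E →L[ℂ] E, IsStarProjection P ∧
      (∀ k, ∀ x ∈ K k, ‖x‖ ^ 2 / 2 ≤ ‖P x‖ ^ 2) ∧
      ∀ x, ‖P x‖ ^ 2 ≤ 2 * ∑ k, ‖(K k).starProjection x‖ ^ 2 := by
  classical
  set T : E →ₗ[ℂ] E := ∑ k, ((K k).starProjection : E →ₗ[ℂ] E) with hT
  have hsym : T.IsSymmetric := isSymmetric_sum_starProjection K
  set b := hsym.eigenvectorBasis rfl with hb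
  set μ := hsym.eigenvalues rfl with hμ
  have hrepr : ∀ v i, b.repr (T v) i = (μ i : ℂ) * b.repr v i :=
    fun v i => hsym.eigenvectorBasis_apply_self_apply rfl v i
  have hnorm : ∀ v, ‖v‖ ^ 2 = ∑ i, ‖b.repr v i‖ ^ 2 := fun v => by
    rw [← b.repr.norm_map v, EuclideanSpace.norm_sq_eq]
  have hinner : ∀ v w, inner ℂ v w = ∑ i, inner ℂ (b.repr v i) (b.repr w i) := fun v w => by
    rw [← b.repr.inner_map_map v w, PiLp.inner_apply]
  have hquad : ∀ v, ∑ k, ‖(K k).starProjection v‖ ^ 2 = ∑ i, μ i * ‖b.repr v i‖ ^ 2 := by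
    intro v
    rw [← inner_sum_starProjection_self, ← hT, hinner, Complex.re_sum]
    refine Finset.sum_congr rfl fun i _ => ?_
    rw [hrepr, ← smul_eq_mul, inner_smul_right, inner_self_eq_norm_sq_to_K]
    norm_cast
    rw [Complex.re_ofReal_mul]
    rfl
  have hμ0 : ∀ i, 0 ≤ μ i := by
    intro i
    have h := hquad (b i)
    have h2 : ∑ j, μ j * ‖b.repr (b i) j‖ ^ 2 = μ i := by
      rw [Finset.sum_eq_single i] <;> simp +contextual
    rw [← h2, ← h]
    positivity
  -- Spectral cutoff: `P` projects to the eigenvectors of `T` with eigenvalue at least one half.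
  set χ : Fin (Module.finrank ℂ E) → ℂ := fun i => if 1 / 2 ≤ μ i then 1 else 0 with hχ
  let P₀ : E →ₗ[ℂ] E :=
    { toFun := fun v => b.repr.symm (WithLp.toLp 2 fun i => χ i * b.repr v i)
      map_add' := fun v w => by
        rw [← map_add]; congr 1; ext i; simp [mul_add]
      map_smul' := fun c v => by
        rw [RingHom.id_apply, ← map_smul]; congr 1; ext i; simp; ring }
  let P : E →L[ℂ] E := LinearMap.toContinuousLinearMap P₀
  have hP : ∀ v i, b.repr (P v) i = χ i * b.repr v i := by
    intro v i
    show b.repr (b.repr.symm _) i = _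
    rw [LinearIsometryEquiv.apply_symm_apply]
  have hPproj : IsStarProjection P := by
    rw [ContinuousLinearMap.isStarProjection_iff_isSymmetricProjection]
    refine ⟨?_, ?_⟩
    · ext v
      refine b.repr.injective (PiLp.ext fun i => ?_)
      show b.repr (P (P v)) i = b.repr (P v) i
      rw [hP, hP]
      simp only [hχ]
      split_ifs <;> simp
    · intro v w
      show inner ℂ (P v) w = inner ℂ v (P w)
      rw [hinner, hinner]
      refine Finset.sum_congr rfl fun i _ => ?_
      rw [hP, hP]
      simp only [hχ]
      split_ifs <;> simp
  have hPsq : ∀ v, ‖P v‖ ^ 2 = ∑ i, if 1 / 2 ≤ μ i then ‖b.repr v i‖ ^ 2 else 0 := by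
    intro v
    rw [hnorm]
    refine Finset.sum_congr rfl fun i _ => ?_
    rw [hP]
    simp only [hχ]
    split_ifs <;> simp
  have hQ : ∀ v, ‖v‖ ^ 2 = ‖P v‖ ^ 2 + ‖v - P v‖ ^ 2 := by
    intro v
    rw [hPsq, hnorm v, hnorm (v - P v), ← Finset.sum_add_distrib]
    refine Finset.sum_congr rfl fun i _ => ?_
    rw [map_sub, PiLp.sub_apply, hP]
    simp only [hχ]
    split_ifs <;> simp
  refine ⟨P, hPproj, fun k x hx => ?_, fun x => ?_⟩
  -- The rejected part `y` lives on eigenvalues below `1/2`, so its projection to `K k` is short. As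
  -- `x ∈ K k`, `‖y‖² = ⟨x, y⟩` sees only that projection, and Cauchy-Schwarz bounds `‖y‖`.
  · set y := x - P x with hy
    have hlow : ‖(K k).starProjection y‖ ^ 2 ≤ ‖y‖ ^ 2 / 2 := by
      calc ‖(K k).starProjection y‖ ^ 2 ≤ ∑ k, ‖(K k).starProjection y‖ ^ 2 :=
            Finset.single_le_sum (f := fun k => ‖(K k).starProjection y‖ ^ 2)
              (fun _ _ => by positivity) (Finset.mem_univ k)
        _ = ∑ i, μ i * ‖b.repr y i‖ ^ 2 := hquad y
        _ ≤ ∑ i, 1 / 2 * ‖b.repr y i‖ ^ 2 := by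
            refine Finset.sum_le_sum fun i _ => ?_
            by_cases h : 1 / 2 ≤ μ i
            · have : b.repr y i = 0 := by
                rw [hy, map_sub, PiLp.sub_apply, hP]; simp only [hχ, if_pos h, one_mul, sub_self]
              simp [this]
            · exact mul_le_mul_of_nonneg_right (not_le.1 h).le (by positivity)
        _ = ‖y‖ ^ 2 / 2 := by rw [← Finset.mul_sum, ← hnorm]; ring
    have horth : inner ℂ (P x) y = 0 := by
      rw [hinner]
      refine Finset.sum_eq_zero fun i _ => ?_
      rw [hy, map_sub, PiLp.sub_apply, hP]
      simp only [hχ]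
      split_ifs <;> simp
    have hxy : inner ℂ x y = ((‖y‖ ^ 2 : ℝ) : ℂ) := by
      have : x = P x + y := by rw [hy]; abel
      conv_lhs => rw [this]
      rw [inner_add_left, horth, zero_add, inner_self_eq_norm_sq_to_K]
      norm_cast
    have hxy2 : inner ℂ x y = inner ℂ x ((K k).starProjection y) := by
      rw [← (K k).inner_starProjection_left_eq_right,
        Submodule.starProjection_eq_self_iff.2 hx]
    have hcs : ‖y‖ ^ 2 ≤ ‖x‖ * ‖(K k).starProjection y‖ := by
      have := norm_inner_le_norm (𝕜 := ℂ) x ((K k).starProjection y)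
      rw [← hxy2, hxy, Complex.norm_real, Real.norm_of_nonneg (by positivity)] at this
      exact this
    have h4 : (‖y‖ ^ 2) ^ 2 ≤ ‖x‖ ^ 2 * (‖y‖ ^ 2 / 2) := by
      calc (‖y‖ ^ 2) ^ 2 ≤ (‖x‖ * ‖(K k).starProjection y‖) ^ 2 := by gcongr
        _ = ‖x‖ ^ 2 * ‖(K k).starProjection y‖ ^ 2 := by ring
        _ ≤ _ := by gcongr
    have h5 : ‖y‖ ^ 2 ≤ ‖x‖ ^ 2 / 2 := by
      rcases (sq_nonneg ‖y‖).eq_or_lt with h | h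
      · rw [← h]; positivity
      · nlinarith
    linarith [hQ x]
  · rw [hPsq, hquad, Finset.mul_sum]
    refine Finset.sum_le_sum fun i _ => ?_
    split_ifs with h
    · nlinarith [sq_nonneg ‖b.repr x i‖]
    · exact mul_nonneg two_pos.le (mul_nonneg (hμ0 i) (by positivity))

/-- The matrix of a projection as in `exists_detector`. -/
theorem exists_detector_matrix {ι κ : Type*} [Fintype ι] [DecidableEq ι] [Fintype κ]
    (K : κ → Submodule ℂ (EuclideanSpace ℂ ι)) :
    ∃ M : Matrix ι ι ℂ, IsStarProjection M ∧
      (∀ k, ∀ x ∈ K k, ‖x‖ ^ 2 / 2 ≤ ∑ i, ‖(M *ᵥ x.ofLp) i‖ ^ 2) ∧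
      ∀ x : EuclideanSpace ℂ ι,
        ∑ i, ‖(M *ᵥ x.ofLp) i‖ ^ 2 ≤ 2 * ∑ k, ‖(K k).starProjection x‖ ^ 2 := by
  obtain ⟨P, hP, h1, h2⟩ := exists_detector K
  obtain ⟨M, hMP⟩ := (Matrix.toEuclideanCLM (n := ι) (𝕜 := ℂ)).surjective P
  change Matrix.toEuclideanCLM (n := ι) (𝕜 := ℂ) M = P at hMP
  subst hMP
  have hM : ∀ x : EuclideanSpace ℂ ι,
      ‖Matrix.toEuclideanCLM (n := ι) (𝕜 := ℂ) M x‖ ^ 2 = ∑ i, ‖(M *ᵥ x.ofLp) i‖ ^ 2 := by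
    intro x
    rw [EuclideanSpace.norm_sq_eq]
    rfl
  refine ⟨M, ⟨?_, ?_⟩, fun k x hx => (h1 k x hx).trans_eq (hM x),
    fun x => (hM x).symm.trans_le (h2 x)⟩
  · refine (Matrix.toEuclideanCLM (n := ι) (𝕜 := ℂ)).injective ?_
    exact (map_mul (Matrix.toEuclideanCLM (n := ι) (𝕜 := ℂ)) M M).trans hP.isIdempotentElem
  · refine (Matrix.toEuclideanCLM (n := ι) (𝕜 := ℂ)).injective ?_
    exact (map_star (Matrix.toEuclideanCLM (n := ι) (𝕜 := ℂ)) M).trans hP.isSelfAdjoint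

/-- If the vectors of `K` do not distinguish between the members `χ S` with sets `S` of the same
size, and these are nearly orthogonal, then each of them has small projection to `K`. -/
theorem norm_starProjection_sq_le_of_exchangeable {I : Type*} [Fintype I] [DecidableEq I]
    (K : Submodule ℂ E) (χ : Finset I → E) {r : ℝ} (hr : 0 ≤ r)
    (hK : ∀ x ∈ K, ∀ S T : Finset I, S.card = T.card → inner ℂ x (χ S) = inner ℂ x (χ T))
    (hχ : ∀ S T, ‖inner ℂ (χ S) (χ T)‖ ≤ r ^ (symmDiff S T).card) (T : Finset I) :
    ‖K.starProjection (χ T)‖ ^ 2 ≤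
      (1 + r) ^ Fintype.card I / (Fintype.card I).choose T.card := by
  set m := Fintype.card I with hm
  set 𝒮 := Finset.powersetCard T.card (Finset.univ : Finset I) with h𝒮
  have hcard : 𝒮.card = m.choose T.card := by simp [h𝒮, hm]
  have hCpos : (0 : ℝ) < m.choose T.card := by
    exact_mod_cast Nat.choose_pos (Finset.card_le_univ T)
  set x := K.starProjection (χ T) with hx
  have hxK : x ∈ K := Submodule.starProjection_apply_mem _ _
  set σ := ∑ S ∈ 𝒮, χ S with hσ
  have hxT : inner ℂ x (χ T) = ((‖x‖ ^ 2 : ℝ) : ℂ) := by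
    have h : inner ℂ x (χ T) = inner ℂ x (K.starProjection (χ T)) := by
      rw [← K.inner_starProjection_left_eq_right,
        Submodule.starProjection_eq_self_iff.2 hxK]
    rw [h, ← hx, inner_self_eq_norm_sq_to_K]
    norm_cast
  -- All the `χ S` with `S` of the given size contribute equally, so the overlap of `x` with their
  -- sum is the number of terms times `‖x‖ ^ 2`.
  have hxσ : inner ℂ x σ = ((m.choose T.card * ‖x‖ ^ 2 : ℝ) : ℂ) := by
    rw [hσ, inner_sum, Finset.sum_congr rfl fun S hS =>
      (hK x hxK S T (Finset.mem_powersetCard.1 hS).2).trans hxT, Finset.sum_const, hcard]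
    simp
  have hcs : m.choose T.card * ‖x‖ ^ 2 ≤ ‖x‖ * ‖σ‖ := by
    have := norm_inner_le_norm (𝕜 := ℂ) x σ
    rwa [hxσ, Complex.norm_real, Real.norm_of_nonneg (by positivity)] at this
  -- `symmDiff S` permutes the subsets, so every row sum is the binomial expansion of `(1 + r) ^ m`;
  -- extending the sum from sets of one size to all sets only increases it.
  have hrow : ∀ S : Finset I, ∑ S' : Finset I, r ^ (symmDiff S S').card = (1 + r) ^ m := by
    intro S
    refine (Equiv.sum_comp (⟨symmDiff S, symmDiff S, symmDiff_symmDiff_cancel_left S,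
      symmDiff_symmDiff_cancel_left S⟩ : Finset I ≃ Finset I) fun D => r ^ D.card).trans ?_
    have := Fintype.sum_pow_mul_eq_add_pow I r 1
    simp only [one_pow, mul_one] at this
    rw [this, add_comm]
  have hσ2 : ‖σ‖ ^ 2 ≤ m.choose T.card * (1 + r) ^ m := by
    have h1 : ‖σ‖ ^ 2 = ‖inner ℂ σ σ‖ := by
      rw [inner_self_eq_norm_sq_to_K]; simp
    have h2 : inner ℂ σ σ = ∑ S ∈ 𝒮, ∑ S' ∈ 𝒮, inner ℂ (χ S) (χ S') := by
      rw [hσ, sum_inner]; simp_rw [inner_sum]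
    rw [h1, h2, ← hcard, ← nsmul_eq_mul]
    refine (norm_sum_le _ _).trans (Finset.sum_le_card_nsmul _ _ _ fun S _ => ?_)
    refine (norm_sum_le _ _).trans ?_
    rw [← hrow S]
    refine (Finset.sum_le_sum fun S' _ => hχ S S').trans ?_
    exact Finset.sum_le_univ_sum_of_nonneg fun S' => pow_nonneg hr _
  rw [le_div_iff₀ hCpos]
  rcases (norm_nonneg x).eq_or_lt with h | h
  · rw [← h]; simp; positivity
  · have h1 : m.choose T.card * ‖x‖ ≤ ‖σ‖ := by
      refine le_of_mul_le_mul_left ?_ h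
      linarith
    have h2 : (m.choose T.card * ‖x‖) ^ 2 ≤ m.choose T.card * (1 + r) ^ m :=
      (pow_le_pow_left₀ (by positivity) h1 2).trans hσ2
    refine le_of_mul_le_mul_left (a := (m.choose T.card : ℝ)) ?_ hCpos
    linarith

end Detector

/-! ### Tensor products of Choi states -/

/-- The normalized trace of a unitary operator on `n` qubits. -/
def normTrace {n : ℕ} (g : UnitaryOp n) : ℂ := g.1.trace / 2 ^ n

lemma normTrace_one (n : ℕ) : normTrace (1 : UnitaryOp n) = 1 := by
  simp [normTrace]

lemma normTrace_mul_comm {n : ℕ} (g h : UnitaryOp n) : normTrace (g * h) = normTrace (h * g) := by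
  simp only [normTrace, Submonoid.coe_mul]
  rw [Matrix.trace_mul_comm]

lemma norm_normTrace_inv {n : ℕ} (g : UnitaryOp n) : ‖normTrace g⁻¹‖ = ‖normTrace g‖ := by
  have : (g⁻¹ : UnitaryOp n).1.trace = star g.1.trace := by
    rw [← Matrix.trace_conjTranspose]; rfl
  simp only [normTrace, norm_div, this, norm_star]

/-- Moving a sandwich of unitaries from one argument of the overlap to the other. -/
lemma normTrace_sandwich {n : ℕ} (A B U V : UnitaryOp n) :
    normTrace ((B * U * A)⁻¹ * V) = normTrace (U⁻¹ * (B⁻¹ * V * A⁻¹)) := by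
  have h : (B * U * A)⁻¹ * V = A⁻¹ * (U⁻¹ * (B⁻¹ * V)) := by
    simp only [mul_inv_rev, mul_assoc]
  rw [h, normTrace_mul_comm, mul_assoc, mul_assoc]

lemma normTrace_sandwich_self {n : ℕ} (A B Z U : UnitaryOp n) :
    normTrace ((B * Z * A)⁻¹ * (B * U * A)) = normTrace (Z⁻¹ * U) := by
  have h : B⁻¹ * (B * U * A) * A⁻¹ = U := by
    rw [mul_assoc B, inv_mul_cancel_left, mul_inv_cancel_right]
  rw [normTrace_sandwich, h]

lemma norm_normTrace_inv_mul_comm {n : ℕ} (g h : UnitaryOp n) :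
    ‖normTrace (g⁻¹ * h)‖ = ‖normTrace (h⁻¹ * g)‖ := by
  rw [← norm_normTrace_inv, mul_inv_rev, inv_inv]

variable {n t p a : ℕ}

/-- The tensor product of the Choi states of the unitaries `X i`, whose output halves are stored in
the two groups of query registers and whose input halves are stored in the ancillas. -/
def choiState (e : Qubits a ≃ (Fin t ⊕ Fin p → Qubits n)) (X : Fin t ⊕ Fin p → UnitaryOp n) :
    EuclideanSpace ℂ (((Fin t → Qubits n) × (Fin p → Qubits n)) × Qubits a) :=
  WithLp.toLp 2 fun r => ∏ i, (X i).1 (Sum.elim r.1.1 r.1.2 i) (e r.2 i) / (√(2 ^ n) : ℝ)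

lemma inner_choiState (e : Qubits a ≃ (Fin t ⊕ Fin p → Qubits n))
    (X Y : Fin t ⊕ Fin p → UnitaryOp n) :
    inner ℂ (choiState e X) (choiState e Y) = ∏ i, normTrace ((X i)⁻¹ * Y i) := by
  have hsq : ((√(2 ^ n) : ℝ) : ℂ) * ((√(2 ^ n) : ℝ) : ℂ) = 2 ^ n := by
    rw [← Complex.ofReal_mul, Real.mul_self_sqrt (by positivity)]; simp
  have h1 : ∀ i, normTrace ((X i)⁻¹ * Y i) =
      ∑ q : Qubits n × Qubits n, (Y i).1 q.1 q.2 * star ((X i).1 q.1 q.2) / 2 ^ n := by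
    intro i
    rw [normTrace, ← Finset.sum_div, Fintype.sum_prod_type_right]
    congr 1
    refine Finset.sum_congr rfl fun c _ => ?_
    refine Finset.sum_congr rfl fun b _ => ?_
    rw [mul_comm]; rfl
  let f : (((Fin t → Qubits n) × (Fin p → Qubits n)) × Qubits a) ≃
      (Fin t ⊕ Fin p → Qubits n × Qubits n) :=
    ((Equiv.sumArrowEquivProdArrow _ _ _).symm.prodCongr e).trans
      (Equiv.arrowProdEquivProdArrow _ _ _).symm
  simp_rw [h1]
  rw [Fintype.prod_sum, PiLp.inner_apply]
  refine Fintype.sum_equiv f _ _ fun r => ?_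
  simp only [choiState, RCLike.inner_apply]
  rw [map_prod, ← Finset.prod_mul_distrib]
  refine Finset.prod_congr rfl fun i _ => ?_
  have hf : f r i = (Sum.elim r.1.1 r.1.2 i, e r.2 i) := by
    cases i <;> rfl
  rw [hf, map_div₀, Complex.conj_ofReal, div_mul_div_comm, hsq]
  rfl

lemma norm_choiState (e : Qubits a ≃ (Fin t ⊕ Fin p → Qubits n))
    (X : Fin t ⊕ Fin p → UnitaryOp n) : ‖choiState e X‖ = 1 := by
  have h := inner_choiState e X X
  simp only [inv_mul_cancel, normTrace_one, Finset.prod_const_one] at h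
  rw [inner_self_eq_norm_sq_to_K] at h
  have h2 : ‖choiState e X‖ ^ 2 = 1 := by
    have h3 := congrArg Complex.re h
    rw [← RCLike.ofReal_pow] at h3
    exact h3
  exact (pow_eq_one_iff_of_nonneg (norm_nonneg _) two_ne_zero).1 h2

/-- Parallel queries to maximally entangled states prepare Choi states. -/
lemma query_choiState_one (e : Qubits a ≃ (Fin t ⊕ Fin p → Qubits n)) (W U : UnitaryOp n) :
    ((tensorPow t W.1 ⊗ₖ tensorPow p U.1) ⊗ₖ (1 : Matrix (Qubits a) (Qubits a) ℂ)) *ᵥ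
      (choiState e 1).ofLp = (choiState e (Sum.elim (fun _ => W) fun _ => U)).ofLp := by
  ext ⟨⟨x, y⟩, c⟩
  -- For fixed ancilla label `c`, the maximally entangled state is supported on the single query
  -- label `e c`.
  rw [Matrix.mulVec, dotProduct,
    Finset.sum_eq_single ((fun i => e c (Sum.inl i), fun i => e c (Sum.inr i)), c)]
  · have hl : ∀ i, ((1 : Fin t ⊕ Fin p → UnitaryOp n) (Sum.inl i)).1
        (e c (Sum.inl i)) (e c (Sum.inl i)) = 1 := fun i => Matrix.one_apply_eq _
    have hr : ∀ i, ((1 : Fin t ⊕ Fin p → UnitaryOp n) (Sum.inr i)).1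
        (e c (Sum.inr i)) (e c (Sum.inr i)) = 1 := fun i => Matrix.one_apply_eq _
    simp only [choiState, hl, hr, tensorPow, Matrix.kroneckerMap_apply, Matrix.of_apply,
      Matrix.one_apply_eq, mul_one, Finset.prod_div_distrib, Finset.prod_const_one,
      Fintype.prod_sum_type, Sum.elim_inl, Sum.elim_inr]
    exact mul_one_div _ _
  · rintro ⟨⟨x', y'⟩, c'⟩ - hne
    by_cases hc : c = c'
    · subst hc
      have : ∃ i, Sum.elim x' y' i ≠ e c i := by
        by_contra! h
        exact hne (by
          congr 2
          · ext1 i; exact h (Sum.inl i)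
          · ext1 i; exact h (Sum.inr i))
      obtain ⟨i, hi⟩ := this
      refine mul_eq_zero_of_right _ (Finset.prod_eq_zero (Finset.mem_univ i) ?_)
      simp [hi]
    · simp [Matrix.kroneckerMap_apply, hc]
  · simp

/-- The span of the states produced from `B * Z * A` and `Z`, over all unitaries `Z`. -/
def sandwichSpan (e : Qubits a ≃ (Fin t ⊕ Fin p → Qubits n)) (A B : UnitaryOp n) :
    Submodule ℂ (EuclideanSpace ℂ (((Fin t → Qubits n) × (Fin p → Qubits n)) × Qubits a)) :=
  Submodule.span ℂ (Set.range fun Z => choiState e (Sum.elim (fun _ => B * Z * A) fun _ => Z))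

/-- An instance of exchangeability: conjugating by `A` and `B` makes the two kinds of registers
equivalent from the viewpoint of the span. -/
lemma norm_starProjection_sandwichSpan_sq_le (e : Qubits a ≃ (Fin t ⊕ Fin p → Qubits n))
    (A B V U : UnitaryOp n) :
    ‖(sandwichSpan e A B).starProjection (choiState e (Sum.elim (fun _ => V) fun _ => U))‖ ^ 2 ≤
      (1 + ‖normTrace ((B * U * A)⁻¹ * V)‖) ^ (t + p) / (t + p).choose t := by
  classical
  set r := ‖normTrace ((B * U * A)⁻¹ * V)‖ with hr
  -- The set `S` records which registers hold `V`, the others holding `U`; each is seen through the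
  -- sandwich in a challenge register and undone by it in a common one. The actual state is the case
  -- where `S` is the set of challenge registers.
  let X : Finset (Fin t ⊕ Fin p) → Fin t ⊕ Fin p → UnitaryOp n := fun S i =>
    Sum.elim (fun _ => if i ∈ S then V else B * U * A)
      (fun _ => if i ∈ S then B⁻¹ * V * A⁻¹ else U) i
  set T : Finset (Fin t ⊕ Fin p) := Finset.univ.map Function.Embedding.inl with hT
  have hXT : X T = Sum.elim (fun _ => V) fun _ => U := by
    ext1 i; cases i <;> simp [X, hT]
  have hTcard : T.card = t := by simp [hT]
  have key := norm_starProjection_sq_le_of_exchangeable (sandwichSpan e A B)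
    (fun S => choiState e (X S)) (r := r) (norm_nonneg _) ?_ ?_ T
  · simpa [hXT, hTcard] using key
  · intro x hx S S' hS
    induction hx using Submodule.span_induction with
    | mem x hx =>
      obtain ⟨Z, rfl⟩ := hx
      -- Each register of `S` contributes the same factor whichever group it belongs to, and
      -- likewise outside `S`; only the size of `S` matters.
      have h : ∀ S, inner ℂ (choiState e (Sum.elim (fun _ => B * Z * A) fun _ => Z))
          (choiState e (X S)) = normTrace (Z⁻¹ * (B⁻¹ * V * A⁻¹)) ^ S.card *
            normTrace (Z⁻¹ * U) ^ (Fintype.card (Fin t ⊕ Fin p) - S.card) := by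
        intro S
        rw [inner_choiState, ← Finset.card_compl, ← Finset.prod_const, ← Finset.prod_const,
          ← Finset.prod_mul_prod_compl S]
        congr 1
        · refine Finset.prod_congr rfl fun i hi => ?_
          rcases i with i | i
          · simp only [X, Sum.elim_inl, if_pos hi]
            exact normTrace_sandwich A B Z V
          · simp only [X, Sum.elim_inr, if_pos hi]
        · refine Finset.prod_congr rfl fun i hi => ?_
          rw [Finset.mem_compl] at hi
          rcases i with i | i
          · simp only [X, Sum.elim_inl, if_neg hi]
            exact normTrace_sandwich_self A B Z U
          · simp only [X, Sum.elim_inr, if_neg hi]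
      simp only [h, hS]
    | zero => simp
    | add x y _ _ hx hy => rw [inner_add_left, inner_add_left, hx, hy]
    | smul c x _ hx => rw [inner_smul_left, inner_smul_left, hx]
  · intro S S'
    rw [inner_choiState, norm_prod, ← Finset.prod_mul_prod_compl (symmDiff S S')]
    have h2 : ∏ i ∈ (symmDiff S S')ᶜ, ‖normTrace ((X S i)⁻¹ * X S' i)‖ = 1 := by
      refine Finset.prod_eq_one fun i hi => ?_
      rw [Finset.mem_compl, Finset.mem_symmDiff] at hi
      have : X S i = X S' i := by
        have h : i ∈ S ↔ i ∈ S' := by tauto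
        simp only [X, h]
      rw [this, inv_mul_cancel, normTrace_one, norm_one]
    have h3 : ∏ i ∈ symmDiff S S', ‖normTrace ((X S i)⁻¹ * X S' i)‖ = r ^ (symmDiff S S').card := by
      refine Finset.prod_eq_pow_card fun i hi => ?_
      rw [Finset.mem_symmDiff] at hi
      rcases hi with ⟨h, h'⟩ | ⟨h, h'⟩ <;> rcases i with i | i <;>
        simp only [X, Sum.elim_inl, Sum.elim_inr, if_pos h, if_neg h']
      · exact norm_normTrace_inv_mul_comm _ _
      · rw [norm_normTrace_inv_mul_comm, ← normTrace_sandwich]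
      · rfl
      · rw [← normTrace_sandwich]
    rw [h2, h3, mul_one]

/-! ### The advantage of the Choi-state distinguisher -/

lemma NonadaptiveAdversary.continuous_acceptProb (𝒜 : NonadaptiveAdversary n) :
    Continuous fun q : UnitaryOp n × UnitaryOp n => 𝒜.acceptProb q.1 q.2 := by
  have hval : Continuous fun V : UnitaryOp n => V.1 := continuous_subtype_val
  have hW : ∀ i j, Continuous fun q : UnitaryOp n × UnitaryOp n => q.1.1 i j := fun i j =>
    (hval.comp continuous_fst).matrix_elem i j
  have hU : ∀ i j, Continuous fun q : UnitaryOp n × UnitaryOp n => q.2.1 i j := fun i j =>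
    (hval.comp continuous_snd).matrix_elem i j
  unfold NonadaptiveAdversary.acceptProb
  simp only [Matrix.mulVec, dotProduct, Matrix.kroneckerMap_apply, tensorPow, Matrix.of_apply]
  refine continuous_finsetSum _ fun x _ => Continuous.pow (Continuous.norm ?_) 2
  refine continuous_finsetSum _ fun y _ => continuous_const.mul ?_
  refine continuous_finsetSum _ fun z _ => Continuous.mul (Continuous.mul (Continuous.mul ?_ ?_)
    continuous_const) continuous_const
  · exact continuous_finsetProd _ fun i _ => hW _ _
  · exact continuous_finsetProd _ fun i _ => hU _ _

lemma NonadaptiveAdversary.acceptProb_nonneg (𝒜 : NonadaptiveAdversary n) (W U : UnitaryOp n) :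
    0 ≤ 𝒜.acceptProb W U :=
  Finset.sum_nonneg fun _ _ => by positivity

/-- A non-adaptive distinguisher for `B k * U * A k` and an independent Haar unitary. -/
theorem exists_nonadaptive_distinguisher (lam n t p : ℕ)
    (G : Qubits lam → UnitaryOp n → UnitaryOp n)
    (hG : ∀ k, ∃ A B : UnitaryOp n, ∀ U : UnitaryOp n, G k U = B * U * A) :
    ∃ 𝒜 : NonadaptiveAdversary n, 𝒜.numChallenge = t ∧ 𝒜.numHaar = p ∧
      1 / 2 - 4 * 2 ^ lam * Real.exp (2 * (t + p) ^ 2 / 2 ^ n) / (t + p).choose t ≤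
        advantage lam G 𝒜.acceptProb := by
  choose A B hAB using hG
  have hcard : Fintype.card (Qubits (n * (t + p))) = Fintype.card (Fin t ⊕ Fin p → Qubits n) := by
    simp [pow_mul]
  let e : Qubits (n * (t + p)) ≃ (Fin t ⊕ Fin p → Qubits n) := Fintype.equivOfCardEq hcard
  obtain ⟨M, hM, hacc, hrej⟩ := exists_detector_matrix fun k => sandwichSpan e (A k) (B k)
  let 𝒜 : NonadaptiveAdversary n :=
    ⟨t, p, n * (t + p), (choiState e 1).ofLp,
      by rw [← EuclideanSpace.norm_sq_eq, norm_choiState, one_pow], M, hM⟩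
  have hprob : ∀ W U, 𝒜.acceptProb W U =
      ∑ x, ‖(M *ᵥ (choiState e (Sum.elim (fun _ => W) fun _ => U)).ofLp) x‖ ^ 2 := by
    intro W U
    rw [← query_choiState_one e W U]
    rfl
  refine ⟨𝒜, rfl, rfl, ?_⟩
  have hreal : ∀ k, (1 / 2 : ℝ) ≤ ∫ U, 𝒜.acceptProb (G k U) U ∂(haarUnitary n) := by
    intro k
    have hpair : Continuous fun U : UnitaryOp n => (B k * U * A k, U) :=
      ((continuous_const.mul continuous_id).mul continuous_const).prodMk continuous_id
    have hle : ∀ U, (1 / 2 : ℝ) ≤ 𝒜.acceptProb (B k * U * A k) U := by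
      intro U
      have := hacc k (choiState e (Sum.elim (fun _ => B k * U * A k) fun _ => U))
        (Submodule.subset_span ⟨U, rfl⟩)
      rwa [norm_choiState, one_pow, ← hprob] at this
    have h := MeasureTheory.integral_mono (μ := haarUnitary n)
      (MeasureTheory.integrable_const (1 / 2 : ℝ))
      (integrable_of_continuous (𝒜.continuous_acceptProb.comp hpair)) hle
    simp only [hAB]
    simpa using h
  -- The factor `4` combines the `2` of the detector with the `2` of the moment bound; `2 ^ lam` is
  -- the union over keys.
  set C : ℝ := 4 * 2 ^ lam * Real.exp (2 * (t + p) ^ 2 / 2 ^ n) / (t + p).choose t with hC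
  have hideal : ∫ U, ∫ V, 𝒜.acceptProb V U ∂(haarUnitary n) ∂(haarUnitary n) ≤ C := by
    -- The average over `V` alone suffices: the bound is uniform in `U`.
    have hU : ∀ U, ∫ V, 𝒜.acceptProb V U ∂(haarUnitary n) ≤ C := by
      intro U
      have hint : ∀ k, MeasureTheory.Integrable (fun V : UnitaryOp n =>
          (1 + ‖normTrace ((B k * U * A k)⁻¹ * V)‖) ^ (t + p)) (haarUnitary n) := by
        intro k
        refine integrable_of_continuous ((continuous_const.add (Continuous.norm ?_)).pow _)
        exact (continuous_trace_unitaryOp (n := n) ((B k * U * A k)⁻¹ : UnitaryOp n).1).div_const _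
      have hbound : ∀ V, 𝒜.acceptProb V U ≤
          2 * ∑ k, (1 + ‖normTrace ((B k * U * A k)⁻¹ * V)‖) ^ (t + p) / (t + p).choose t := by
        intro V
        rw [hprob]
        refine (hrej _).trans ?_
        gcongr with k
        exact norm_starProjection_sandwichSpan_sq_le e (A k) (B k) V U
      calc ∫ V, 𝒜.acceptProb V U ∂(haarUnitary n)
          ≤ ∫ V, 2 * ∑ k, (1 + ‖normTrace ((B k * U * A k)⁻¹ * V)‖) ^ (t + p) /
              (t + p).choose t ∂(haarUnitary n) := by
            refine MeasureTheory.integral_mono_of_nonneg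
              (Filter.Eventually.of_forall fun V => 𝒜.acceptProb_nonneg V U)
              ((MeasureTheory.integrable_finsetSum _ fun k _ =>
                (hint k).div_const _).const_mul 2) (Filter.Eventually.of_forall hbound)
        _ = 2 * ∑ k, (∫ V, (1 + ‖normTrace ((B k * U * A k)⁻¹ * V)‖) ^ (t + p)
              ∂(haarUnitary n)) / (t + p).choose t := by
            rw [MeasureTheory.integral_const_mul,
              MeasureTheory.integral_finsetSum _ fun k _ => (hint k).div_const _]
            simp_rw [MeasureTheory.integral_div]
        _ ≤ 2 * ∑ _k : Qubits lam,
              2 * Real.exp (2 * (t + p) ^ 2 / 2 ^ n) / (t + p).choose t := by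
            gcongr with k
            have := integral_one_add_trace_pow_le n (t + p) (B k * U * A k)
            push_cast at this
            exact this
        _ = C := by
            rw [Finset.sum_const, Finset.card_univ, hC]
            simp
            ring
    have h := MeasureTheory.integral_mono_of_nonneg (μ := haarUnitary n)
      (f := fun U => ∫ V, 𝒜.acceptProb V U ∂(haarUnitary n)) (g := fun _ => C)
      (Filter.Eventually.of_forall fun U =>
        MeasureTheory.integral_nonneg fun V => 𝒜.acceptProb_nonneg V U)
      (MeasureTheory.integrable_const _) (Filter.Eventually.of_forall hU)
    simpa using h
  have hmean : (1 / 2 : ℝ) ≤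
      (∑ k : Qubits lam, ∫ U, 𝒜.acceptProb (G k U) U ∂(haarUnitary n)) / 2 ^ lam := by
    rw [le_div_iff₀ (by positivity)]
    have := Finset.sum_le_sum fun k (_ : k ∈ (Finset.univ : Finset (Qubits lam))) => hreal k
    rw [Finset.sum_const, Finset.card_univ] at this
    simp only [Fintype.card_pi, Fintype.card_bool, Finset.prod_const, Finset.card_univ,
      Fintype.card_fin, nsmul_eq_mul] at this
    push_cast at this
    linarith
  refine le_trans ?_ (le_abs_self _)
  linarith

/-! ### Adaptive simulation of non-adaptive adversaries -/

/-- A unit vector is the image of a given basis vector under some unitary. -/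
lemma exists_unitary_mulVec_single {ι : Type*} [Fintype ι] [DecidableEq ι] (x₀ : ι) (φ : ι → ℂ)
    (hφ : ∑ x, ‖φ x‖ ^ 2 = 1) :
    ∃ V : Matrix.unitaryGroup ι ℂ, (V : Matrix ι ι ℂ) *ᵥ Pi.single x₀ 1 = φ := by
  let v : EuclideanSpace ℂ ι := WithLp.toLp 2 φ
  have hv : ‖v‖ = 1 := by
    have : ‖v‖ ^ 2 = 1 := by rw [EuclideanSpace.norm_sq_eq]; exact hφ
    exact (pow_eq_one_iff_of_nonneg (norm_nonneg _) two_ne_zero).1 this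
  have ho : Orthonormal ℂ (({x₀} : Set ι).domRestrict fun _ => v) := by
    refine ⟨fun _ => hv, fun i j hij => absurd (Subsingleton.elim i j) hij⟩
  obtain ⟨b, hb⟩ := ho.exists_orthonormalBasis_extension_of_card_eq (by simp)
  refine ⟨⟨_, (EuclideanSpace.basisFun ι ℂ).toMatrix_orthonormalBasis_mem_unitary b⟩, ?_⟩
  ext x
  rw [Matrix.mulVec_single_one]
  show (EuclideanSpace.basisFun ι ℂ).toBasis.repr (b x₀) x = φ x
  rw [hb x₀ rfl]
  rfl

/-- Unitaries preserve the total weight of a vector. -/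
lemma sum_norm_sq_unitary_mulVec {ι : Type*} [Fintype ι] [DecidableEq ι]
    (V : Matrix.unitaryGroup ι ℂ) (φ : ι → ℂ) :
    ∑ x, ‖((V : Matrix ι ι ℂ) *ᵥ φ) x‖ ^ 2 = ∑ x, ‖φ x‖ ^ 2 := by
  have h : ∀ ψ : ι → ℂ, ((∑ x, ‖ψ x‖ ^ 2 : ℝ) : ℂ) = star ψ ⬝ᵥ ψ := by
    intro ψ
    rw [dotProduct, Complex.ofReal_sum]
    refine Finset.sum_congr rfl fun x _ => ?_
    rw [Pi.star_apply, Complex.ofReal_pow]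
    exact (Complex.conj_mul' _).symm
  apply Complex.ofReal_injective
  rw [h, h, Matrix.star_mulVec, ← Matrix.dotProduct_mulVec, Matrix.mulVec_mulVec,
    ← Matrix.star_eq_conjTranspose, Matrix.UnitaryGroup.star_mul_self, Matrix.one_mulVec]

/-- The permutation unitary that moves amplitudes from one labelling of a basis to another. -/
def relabelUnitary {ρ ι : Type*} [Fintype ρ] [DecidableEq ρ] [Fintype ι] [DecidableEq ι]
    (f g : ρ ≃ ι) : Matrix.unitaryGroup ι ℂ :=
  ⟨(1 : Matrix ρ ρ ℂ).submatrix g.symm f.symm, by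
    rw [Matrix.mem_unitaryGroup_iff, Matrix.star_eq_conjTranspose, Matrix.conjTranspose_submatrix,
      Matrix.submatrix_mul_equiv]
    simp⟩

lemma relabelUnitary_mulVec {ρ ι : Type*} [Fintype ρ] [DecidableEq ρ] [Fintype ι] [DecidableEq ι]
    (f g : ρ ≃ ι) (ψ : ρ → ℂ) :
    (relabelUnitary f g : Matrix ι ι ℂ) *ᵥ (ψ ∘ f.symm) = ψ ∘ g.symm := by
  show (1 : Matrix ρ ρ ℂ).submatrix g.symm f.symm *ᵥ (ψ ∘ f.symm) = _
  rw [Matrix.submatrix_mulVec_equiv]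
  simp [Function.comp_assoc]

/-- A projective measurement in a rotated and relabelled basis. -/
lemma isStarProjection_rotate {ρ ι : Type*} [Fintype ρ] [Fintype ι] [DecidableEq ι]
    (h : ρ ≃ ι) (V : Matrix.unitaryGroup ι ℂ) {M : Matrix ρ ρ ℂ} (hM : IsStarProjection M) :
    IsStarProjection (star V.1 * M.submatrix h.symm h.symm * V.1) := by
  have hVV : V.1 * star V.1 = 1 := Matrix.mem_unitaryGroup_iff.1 V.2
  refine ⟨?_, ?_⟩
  · calc star V.1 * M.submatrix h.symm h.symm * V.1 *
          (star V.1 * M.submatrix h.symm h.symm * V.1)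
        = star V.1 * M.submatrix h.symm h.symm * (V.1 * star V.1) *
            M.submatrix h.symm h.symm * V.1 := by simp only [mul_assoc]
      _ = star V.1 * (M.submatrix h.symm h.symm * M.submatrix h.symm h.symm) * V.1 := by
          rw [hVV, mul_one]; simp only [mul_assoc]
      _ = _ := by rw [Matrix.submatrix_mul_equiv, hM.isIdempotentElem.eq]
  · rw [isSelfAdjoint_iff, star_mul, star_mul, star_star, mul_assoc]
    congr 2
    rw [Matrix.star_eq_conjTranspose, Matrix.conjTranspose_submatrix,
      ← Matrix.star_eq_conjTranspose, hM.isSelfAdjoint.star_eq]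

lemma sum_norm_sq_rotate {ρ ι : Type*} [Fintype ρ] [Fintype ι] [DecidableEq ι]
    (h : ρ ≃ ι) (V : Matrix.unitaryGroup ι ℂ) (M : Matrix ρ ρ ℂ) {ψ : ι → ℂ} {χ : ρ → ℂ}
    (hψ : V.1 *ᵥ ψ = χ ∘ h.symm) :
    ∑ x, ‖((star V.1 * M.submatrix h.symm h.symm * V.1) *ᵥ ψ) x‖ ^ 2 =
      ∑ x, ‖(M *ᵥ χ) x‖ ^ 2 := by
  rw [mul_assoc, ← Matrix.mulVec_mulVec, ← Matrix.mulVec_mulVec, hψ]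
  refine (sum_norm_sq_unitary_mulVec V⁻¹ _).trans ?_
  rw [Matrix.submatrix_mulVec_equiv, Function.comp_assoc, Equiv.symm_symm,
    Equiv.symm_comp_self, Function.comp_id]
  exact Equiv.sum_comp h.symm fun x => ‖(M *ᵥ χ) x‖ ^ 2

/-! ### Bringing each query register in turn to the single oracle register -/

section Simulation

variable {n t p a : ℕ}

/-- The tensor product of operators on the query registers and the identity on the ancillas. -/
def registerOp (M : Fin t ⊕ Fin p → Matrix (Qubits n) (Qubits n) ℂ) :
    Matrix (((Fin t → Qubits n) × (Fin p → Qubits n)) × Qubits a)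
      (((Fin t → Qubits n) × (Fin p → Qubits n)) × Qubits a) ℂ :=
  Matrix.of fun r s => (∏ i, M i (Sum.elim r.1.1 r.1.2 i) (Sum.elim s.1.1 s.1.2 i)) *
    (1 : Matrix (Qubits a) (Qubits a) ℂ) r.2 s.2

lemma registerOp_sum_elim (W U : Matrix (Qubits n) (Qubits n) ℂ) :
    registerOp (Sum.elim (fun _ => W) fun _ => U) =
      (tensorPow t W ⊗ₖ tensorPow p U) ⊗ₖ (1 : Matrix (Qubits a) (Qubits a) ℂ) := by
  ext r s
  simp [registerOp, tensorPow, Matrix.kroneckerMap_apply]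

lemma registerOp_one : registerOp (n := n) (t := t) (p := p) (a := a) (fun _ => 1) = 1 := by
  ext ⟨⟨x, y⟩, c⟩ ⟨⟨x', y'⟩, c'⟩
  by_cases h : ((x, y), c) = ((x', y'), c')
  · simp only [Prod.mk.injEq] at h
    obtain ⟨⟨rfl, rfl⟩, rfl⟩ := h
    simp [registerOp]
  · rw [Matrix.one_apply_ne h]
    by_cases hc : c = c'
    · have : ∃ i, Sum.elim x y i ≠ Sum.elim x' y' i := by
        by_contra! h'
        exact h (by
          congr 2
          · ext1 i; exact h' (Sum.inl i)
          · ext1 i; exact h' (Sum.inr i))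
      obtain ⟨i, hi⟩ := this
      refine mul_eq_zero_of_left (Finset.prod_eq_zero (Finset.mem_univ i) ?_) _
      exact Matrix.one_apply_ne hi
    · simp [registerOp, hc]

lemma registerOp_mul (M N : Fin t ⊕ Fin p → Matrix (Qubits n) (Qubits n) ℂ) :
    registerOp (a := a) M * registerOp N = registerOp fun i => M i * N i := by
  ext r s
  rw [Matrix.mul_apply, Fintype.sum_prod_type]
  simp only [registerOp, Matrix.of_apply]
  have h1 : ∀ i, (M i * N i) (Sum.elim r.1.1 r.1.2 i) (Sum.elim s.1.1 s.1.2 i) =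
      ∑ b, M i (Sum.elim r.1.1 r.1.2 i) b * N i b (Sum.elim s.1.1 s.1.2 i) :=
    fun i => Matrix.mul_apply
  simp only [h1]
  rw [Fintype.prod_sum, Finset.sum_mul]
  refine Fintype.sum_equiv (Equiv.sumArrowEquivProdArrow _ _ _).symm _ _ fun q => ?_
  have h2 := congrFun (congrFun (one_mul (1 : Matrix (Qubits a) (Qubits a) ℂ)) r.2) s.2
  rw [Matrix.mul_apply] at h2
  have hq : ((Equiv.sumArrowEquivProdArrow (Fin t) (Fin p) (Qubits n)).symm q) =
    Sum.elim q.1 q.2 := rfl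
  rw [← h2, Finset.mul_sum, hq, Finset.prod_mul_distrib]
  refine Finset.sum_congr rfl fun c _ => ?_
  ring

/-- The registers of a non-adaptive adversary, with one query register separated from the rest. -/
def splitRegister (i : Fin t ⊕ Fin p) :
    (((Fin t → Qubits n) × (Fin p → Qubits n)) × Qubits a) ≃
      Qubits n × (({j : Fin t ⊕ Fin p // j ≠ i} → Qubits n) × Qubits a) :=
  (((Equiv.sumArrowEquivProdArrow _ _ _).symm.trans (Equiv.funSplitAt i _)).prodCongr
    (Equiv.refl _)).trans (Equiv.prodAssoc _ _ _)

/-- Labels of the query register and of the ancillas of an adaptive adversary, such that the query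
register is the given query register of a non-adaptive adversary. -/
def queryLabels (i : Fin t ⊕ Fin p) :
    (((Fin t → Qubits n) × (Fin p → Qubits n)) × Qubits a) ≃
      Qubits n × Qubits (n * (t + p - 1) + a) :=
  -- The `t + p - 1` idle query registers become ancillas. The truncated subtraction is harmless,
  -- since the existence of `i` gives `0 < t + p`.
  (splitRegister i).trans <| (Equiv.refl _).prodCongr <| Fintype.equivOfCardEq <| by
    simp [Fintype.card_subtype_compl, pow_add, pow_mul]

lemma kronecker_submatrix_queryLabels (i : Fin t ⊕ Fin p) (O : Matrix (Qubits n) (Qubits n) ℂ) :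
    (O ⊗ₖ (1 : Matrix (Qubits (n * (t + p - 1) + a)) (Qubits (n * (t + p - 1) + a)) ℂ)).submatrix
      (queryLabels i) (queryLabels i) = registerOp (Function.update (fun _ => 1) i O) := by
  ext r s
  have h1 : ∀ r : ((Fin t → Qubits n) × (Fin p → Qubits n)) × Qubits a,
      (queryLabels i r).1 = Sum.elim r.1.1 r.1.2 i := fun r => rfl
  have h2 : (queryLabels i r).2 = (queryLabels i s).2 ↔
      (∀ j ≠ i, Sum.elim r.1.1 r.1.2 j = Sum.elim s.1.1 s.1.2 j) ∧ r.2 = s.2 := by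
    show Fintype.equivOfCardEq _ (splitRegister i r).2 =
      Fintype.equivOfCardEq _ (splitRegister i s).2 ↔ _
    rw [EmbeddingLike.apply_eq_iff_eq, Prod.ext_iff, funext_iff, Subtype.forall]
    rfl
  rw [Matrix.submatrix_apply, Matrix.kroneckerMap_apply, h1, h1, Matrix.one_apply]
  simp only [registerOp, Matrix.of_apply]
  rw [Fintype.prod_eq_mul_prod_compl i, Function.update_self]
  by_cases hc : r.2 = s.2
  · by_cases hj : ∀ j ≠ i, Sum.elim r.1.1 r.1.2 j = Sum.elim s.1.1 s.1.2 j
    · rw [if_pos (h2.2 ⟨hj, hc⟩), hc, Matrix.one_apply_eq, mul_one, mul_one]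
      rw [Finset.prod_eq_one, mul_one]
      intro j hj'
      have hne : j ≠ i := by simpa using hj'
      rw [Function.update_of_ne hne, hj j hne, Matrix.one_apply_eq]
    · rw [if_neg fun h => hj (h2.1 h).1, mul_zero]
      push Not at hj
      obtain ⟨j, hne, hj⟩ := hj
      rw [Finset.prod_eq_zero (i := j) (by simpa using hne), mul_zero, zero_mul]
      rw [Function.update_of_ne hne, Matrix.one_apply_ne hj]
  · rw [if_neg fun h => hc (h2.1 h).2, Matrix.one_apply_ne hc, mul_zero, mul_zero]

/-- The oracle queried through a given register. -/
def registerOracle : Fin t ⊕ Fin p → OracleName :=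
  Sum.elim (fun _ => .challenge) fun _ => .haar

/-- One step of an adaptive adversary, as in `Adversary.view`. -/
def oracleStep {anc : ℕ} (W U : UnitaryOp n) (ψ : Qubits n × Qubits anc → ℂ)
    (s : Matrix.unitaryGroup (Qubits n × Qubits anc) ℂ × OracleName) :
    Qubits n × Qubits anc → ℂ :=
  ((match s.2 with
      | .challenge => (W : Matrix (Qubits n) (Qubits n) ℂ)
      | .haar => (U : Matrix (Qubits n) (Qubits n) ℂ)) ⊗ₖ
    (1 : Matrix (Qubits anc) (Qubits anc) ℂ)) *ᵥ
  ((s.1 : Matrix (Qubits n × Qubits anc) (Qubits n × Qubits anc) ℂ) *ᵥ ψ)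

lemma oracleStep_registerOracle {anc : ℕ} (W U : UnitaryOp n) (ψ : Qubits n × Qubits anc → ℂ)
    (V : Matrix.unitaryGroup (Qubits n × Qubits anc) ℂ) (i : Fin t ⊕ Fin p) :
    oracleStep W U ψ (V, registerOracle i) =
      (Sum.elim (fun _ => W.1) (fun _ => U.1) i ⊗ₖ (1 : Matrix (Qubits anc) (Qubits anc) ℂ)) *ᵥ
        (V.1 *ᵥ ψ) := by
  cases i <;> rfl

open scoped Classical in
/-- Steps of an adaptive adversary that make queries through the listed registers of a given state,
up to a final unitary and a relabelling of the basis. -/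
lemma exists_steps (htp : 0 < t + p)
    (φ : ((Fin t → Qubits n) × (Fin p → Qubits n)) × Qubits a → ℂ) (hφ : ∑ x, ‖φ x‖ ^ 2 = 1)
    (l : List (Fin t ⊕ Fin p)) (hl : l.Nodup) :
    ∃ (steps : List (Matrix.unitaryGroup (Qubits n × Qubits (n * (t + p - 1) + a)) ℂ ×
        OracleName))
      (V : Matrix.unitaryGroup (Qubits n × Qubits (n * (t + p - 1) + a)) ℂ)
      (h : (((Fin t → Qubits n) × (Fin p → Qubits n)) × Qubits a) ≃
        Qubits n × Qubits (n * (t + p - 1) + a)),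
      steps.map Prod.snd = l.map registerOracle ∧
      ∀ W U : UnitaryOp n,
        V.1 *ᵥ steps.foldl (oracleStep W U) (Pi.single (fun _ => false, fun _ => false) 1) =
          (registerOp (fun i => if i ∈ l then Sum.elim (fun _ => W.1) (fun _ => U.1) i else 1) *ᵥ
            φ) ∘ h.symm := by
  -- Queries are appended at the end. Leaving `V` and `h` free lets each new step absorb the pending
  -- unitary and choose the register to be queried next.
  induction l using List.reverseRecOn with
  | nil =>
    have i : Fin t ⊕ Fin p := finSumFinEquiv.symm ⟨0, htp⟩
    obtain ⟨V, hV⟩ := exists_unitary_mulVec_single (fun _ => false, fun _ => false)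
      (φ ∘ (queryLabels i).symm) (by
        rw [← hφ]
        exact Equiv.sum_comp (queryLabels i).symm fun x => ‖φ x‖ ^ 2)
    refine ⟨[], V, queryLabels i, rfl, fun W U => ?_⟩
    simp only [List.foldl_nil, List.not_mem_nil, if_false, registerOp_one, Matrix.one_mulVec]
    exact hV
  | append_singleton l i ih =>
    rw [List.nodup_append] at hl
    have hil : i ∉ l := fun hi => hl.2.2 i hi i (by simp) rfl
    obtain ⟨steps, V, h, hmap, hstate⟩ := ih hl.1
    refine ⟨steps ++ [(relabelUnitary h (queryLabels i) * V, registerOracle i)], 1,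
      queryLabels i, by simp [hmap], fun W U => ?_⟩
    set O : Fin t ⊕ Fin p → Matrix (Qubits n) (Qubits n) ℂ :=
      Sum.elim (fun _ => W.1) (fun _ => U.1) with hO
    -- Since `i` is not among the earlier registers, the new query acts where the operator so far is
    -- the identity.
    have hop : registerOp (a := a) (fun j => if j ∈ l ++ [i] then O j else 1) =
        registerOp (Function.update (fun _ => 1) i (O i)) *
          registerOp fun j => if j ∈ l then O j else 1 := by
      rw [registerOp_mul]
      congr 1
      ext1 j
      by_cases hj : j = i
      · subst hj; simp [hil]
      · simp [hj]
    rw [List.foldl_append, List.foldl_cons, List.foldl_nil, oracleStep_registerOracle, hop,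
      ← Matrix.mulVec_mulVec, ← kronecker_submatrix_queryLabels]
    show (1 : Matrix _ _ ℂ) *ᵥ _ = _
    rw [Matrix.one_mulVec]
    show _ *ᵥ (((relabelUnitary h (queryLabels i)).1 * V.1) *ᵥ _) = _
    rw [← Matrix.mulVec_mulVec, hstate, relabelUnitary_mulVec, Matrix.submatrix_mulVec_equiv]
    rw [Function.comp_assoc, Equiv.self_comp_symm, Function.comp_id]

end Simulation

/-- A non-adaptive adversary can be simulated by an adaptive one with the same queries. -/
theorem exists_adaptive_simulation {n : ℕ} (𝒜 : NonadaptiveAdversary n)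
    (hq : 0 < 𝒜.numChallenge + 𝒜.numHaar) :
    ∃ ℬ : Adversary n, ℬ.queries .challenge = 𝒜.numChallenge ∧ ℬ.queries .haar = 𝒜.numHaar ∧
      ℬ.acceptProb = 𝒜.acceptProb := by
  obtain ⟨t, p, a, φ, hφ, M, hM⟩ := 𝒜
  set l : List (Fin t ⊕ Fin p) :=
    (List.finRange t).map Sum.inl ++ (List.finRange p).map Sum.inr with hl
  have hnodup : l.Nodup := by
    rw [hl, List.nodup_append]
    refine ⟨(List.nodup_finRange t).map Sum.inl_injective,
      (List.nodup_finRange p).map Sum.inr_injective, ?_⟩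
    simp
  have hmem : ∀ i, i ∈ l := by
    rintro (i | i) <;> simp [hl]
  obtain ⟨steps, V, h, hmap, hstate⟩ := exists_steps hq φ hφ l hnodup
  have hcount : ∀ o : OracleName, (steps.countP fun s => s.2 = o) =
      (l.map registerOracle).countP fun o' => o' = o := by
    intro o
    rw [← hmap, List.countP_map]
    rfl
  -- The leftover unitary and relabelling are absorbed into the final measurement.
  refine ⟨⟨_, steps, _, isStarProjection_rotate h V hM⟩, ?_, ?_, ?_⟩
  · rw [Adversary.queries, hcount]
    simp [hl, registerOracle, List.countP_replicate, Function.comp_def]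
  · rw [Adversary.queries, hcount]
    simp [hl, registerOracle, List.countP_replicate, Function.comp_def]
  · ext W U
    have hs := hstate W U
    simp only [hmem, if_true] at hs
    rw [registerOp_sum_elim] at hs
    exact sum_norm_sq_rotate h V M hs

/-! ### Choice of parameters -/

/-- A function that is eventually bounded below by a positive constant is not negligible. -/
lemma not_negligible_of_eventually_le {ε : ℕ → ℝ} {c : ℝ} (hc : 0 < c)
    (h : ∀ᶠ lam in Filter.atTop, c ≤ ε lam) : ¬ Negligible ε := by
  rintro ⟨-, hε⟩
  have h0 := hε 0
  simp only [pow_zero, one_mul] at h0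
  exact absurd (ge_of_tendsto h0 h) (not_le.2 hc)

/-- Combines `(p + 1)^t / t! ≤ (t + p).choose t` with `t! ≤ t^t`. -/
lemma pow_le_choose_add (t p : ℕ) : ((p : ℝ) / t) ^ t ≤ (t + p).choose t := by
  have h := Nat.pow_le_choose (α := ℝ) t (t + p)
  refine le_trans ?_ h
  have h1 : t + p + 1 - t = p + 1 := by omega
  rw [h1, div_pow]
  have h2 : (t.factorial : ℝ) ≤ (t : ℝ) ^ t := by exact_mod_cast Nat.factorial_le_pow t
  have h3 : (0 : ℝ) < t.factorial := by exact_mod_cast Nat.factorial_pos t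
  have h4 : (p : ℝ) ≤ ((p + 1 : ℕ) : ℝ) := by push_cast; linarith
  gcongr

/-- With few challenge queries, but enough to exceed the key length, the binomial coefficient beats
the number of keys. -/
lemma two_pow_le_choose {lam l : ℕ} (hlam : 8 ≤ lam)
    (hl : (lam : ℝ) ≤ l * Real.log lam) :
    48 * (2 : ℝ) ^ lam ≤ (min l lam + (lam ^ 3 + 1)).choose (min l lam) := by
  have hlam0 : (8 : ℝ) ≤ lam := by exact_mod_cast hlam
  have hlog : 1 ≤ Real.log lam := by
    rw [Real.le_log_iff_exp_le (by linarith)]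
    linarith [Real.exp_one_lt_d9]
  -- Capping `t` at `lam` keeps the base `p / t` at least `lam ^ 2`. The hypothesis survives the cap
  -- because `log lam ≥ 1`.
  set t := min l lam with ht
  have htl : (lam : ℝ) ≤ t * Real.log lam := by
    rcases min_choice l lam with h | h
    · rw [ht, h]; exact hl
    · rw [ht, h]; nlinarith
  have ht0 : 0 < t := by
    rcases Nat.eq_zero_or_pos t with h | h
    · rw [h] at htl; simp at htl; linarith
    · exact h
  have htlam : (t : ℝ) ≤ lam := by exact_mod_cast min_le_right l lam
  have ht0' : (0 : ℝ) < t := by exact_mod_cast ht0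
  refine le_trans ?_ (pow_le_choose_add t (lam ^ 3 + 1))
  have hbase : (lam : ℝ) ^ 2 ≤ ((lam ^ 3 + 1 : ℕ) : ℝ) / t := by
    rw [le_div_iff₀ ht0']
    push_cast
    nlinarith [mul_le_mul_of_nonneg_left htlam (sq_nonneg (lam : ℝ))]
  -- The power is `exp (2 * t * log lam)`, and `t * log lam ≥ lam`; this is where enough challenge
  -- queries are needed.
  have hexp : Real.exp (2 * lam) ≤ ((lam : ℝ) ^ 2) ^ t := by
    rw [← Real.exp_log (show (0 : ℝ) < ((lam : ℝ) ^ 2) ^ t by positivity), Real.log_pow,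
      Real.log_pow]
    apply Real.exp_le_exp.2
    push_cast
    linarith
  have hseven : (4 : ℝ) ^ lam ≤ Real.exp (2 * lam) := by
    have h1 : (2 : ℝ) ≤ Real.exp 1 := by linarith [Real.exp_one_gt_d9]
    calc (4 : ℝ) ^ lam = (2 ^ 2) ^ lam := by norm_num
      _ ≤ (Real.exp 1 ^ 2) ^ lam := by gcongr
      _ = Real.exp (2 * lam) := by
        rw [← pow_mul, ← Real.exp_nat_mul]
        push_cast
        ring_nf
  have hfour : 48 * (2 : ℝ) ^ lam ≤ 4 ^ lam := by
    have h1 : (48 : ℝ) ≤ 2 ^ lam :=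
      le_trans (by norm_num) (pow_le_pow_right₀ (by norm_num) hlam : (2 : ℝ) ^ 8 ≤ 2 ^ lam)
    calc 48 * (2 : ℝ) ^ lam ≤ 2 ^ lam * 2 ^ lam := by gcongr
      _ = 4 ^ lam := by rw [← mul_pow]; norm_num
  calc 48 * (2 : ℝ) ^ lam ≤ ((lam : ℝ) ^ 2) ^ t := hfour.trans (hseven.trans hexp)
    _ ≤ _ := by gcongr

/-- The total number of queries is at most `2 * lam ^ 3`, so twice its square is at most `8 * lam ^
6 ≤ lam ^ 7`, below `2 ^ n ≥ lam ^ 9`. -/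
lemma queries_sq_le_two_pow {lam n t : ℕ} (hlam : 8 ≤ lam) (ht : t ≤ lam)
    (hn : 9 * Real.log lam ≤ n * Real.log 2) :
    2 * ((t : ℝ) + ((lam ^ 3 + 1 : ℕ) : ℝ)) ^ 2 / 2 ^ n ≤ 1 := by
  have hlam0 : (8 : ℝ) ≤ lam := by exact_mod_cast hlam
  have ht' : (t : ℝ) ≤ lam := by exact_mod_cast ht
  have h1 : (lam : ℝ) ^ 9 ≤ 2 ^ n := by
    rw [← Real.log_le_log_iff (by positivity) (by positivity), Real.log_pow, Real.log_pow]
    exact_mod_cast hn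
  rw [div_le_one (by positivity)]
  refine le_trans ?_ h1
  have h2 : (t : ℝ) + ((lam ^ 3 + 1 : ℕ) : ℝ) ≤ 2 * lam ^ 3 := by
    push_cast
    nlinarith [mul_le_mul hlam0 hlam0 (by norm_num) (by linarith)]
  calc 2 * ((t : ℝ) + ((lam ^ 3 + 1 : ℕ) : ℝ)) ^ 2 ≤ 2 * (2 * lam ^ 3) ^ 2 := by gcongr
    _ = 8 * (lam : ℝ) ^ 6 := by ring
    _ ≤ lam * (lam : ℝ) ^ 6 := by gcongr
    _ = (lam : ℝ) ^ 7 := by ring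
    _ ≤ (lam : ℝ) ^ 9 := pow_le_pow_right₀ (by linarith) (by norm_num)

/-- Non-adaptive adversaries with few challenge queries and polynomially many queries to the common
oracle, whose advantage is at least one quarter for large security parameters. -/
theorem exists_nonadaptive_adversaries (n ℓ : ℕ → ℕ)
    (hn : (fun lam : ℕ => Real.log (lam : ℝ)) =o[Filter.atTop] fun lam : ℕ => (n lam : ℝ))
    (hℓ : (fun lam : ℕ => (lam : ℝ) / Real.log (lam : ℝ)) =o[Filter.atTop]
      fun lam : ℕ => (ℓ lam : ℝ))
    (G : OracleConstruction n)
    (hG : ∀ (lam : ℕ) (k : Qubits lam), ∃ A B : UnitaryOp (n lam),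
      ∀ U : UnitaryOp (n lam), G lam k U = B * U * A) :
    ∃ 𝒜 : ∀ lam, NonadaptiveAdversary (n lam),
      (∀ lam, (𝒜 lam).numChallenge ≤ ℓ lam) ∧ (∀ lam, (𝒜 lam).numHaar = lam ^ 3 + 1) ∧
      ∀ᶠ lam in Filter.atTop, (1 / 4 : ℝ) ≤ advantage lam (G lam) (𝒜 lam).acceptProb := by
  choose 𝒜 h1 h2 h3 using fun lam =>
    exists_nonadaptive_distinguisher lam (n lam) (min (ℓ lam) lam) (lam ^ 3 + 1) (G lam) (hG lam)
  refine ⟨𝒜, fun lam => (h1 lam).trans_le (min_le_left _ _), h2, ?_⟩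
  have hlog2 : 0 < Real.log 2 := Real.log_pos (by norm_num)
  filter_upwards [Filter.eventually_ge_atTop 8, hn.bound (c := Real.log 2 / 9) (by positivity),
    hℓ.bound (c := 1) one_pos] with lam hlam hnl hll
  refine le_trans ?_ (h3 lam)
  have hlam0 : (8 : ℝ) ≤ lam := by exact_mod_cast hlam
  have hlog : 0 < Real.log lam := Real.log_pos (by linarith)
  rw [Real.norm_of_nonneg hlog.le, Real.norm_of_nonneg (Nat.cast_nonneg _)] at hnl
  rw [Real.norm_of_nonneg (by positivity), Real.norm_of_nonneg (Nat.cast_nonneg _), one_mul,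
    div_le_iff₀ hlog] at hll
  have hchoose := two_pow_le_choose hlam hll
  have hexp : Real.exp (2 * (((min (ℓ lam) lam : ℕ) : ℝ) + ((lam ^ 3 + 1 : ℕ) : ℝ)) ^ 2 /
      2 ^ n lam) ≤ 3 :=
    (Real.exp_le_exp.2 (queries_sq_le_two_pow hlam (min_le_right _ _) (by linarith))).trans
      (by linarith [Real.exp_one_lt_d9])
  -- With the exponential at most `3` the numerator is at most `12 * 2 ^ lam`; the constant `48` in
  -- `two_pow_le_choose` makes the quotient at most `1/4`.
  have hfrac : 4 * 2 ^ lam * Real.exp (2 * (((min (ℓ lam) lam : ℕ) : ℝ) +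
      ((lam ^ 3 + 1 : ℕ) : ℝ)) ^ 2 / 2 ^ n lam) /
      (min (ℓ lam) lam + (lam ^ 3 + 1)).choose (min (ℓ lam) lam) ≤ 1 / 4 := by
    have hpos : (0 : ℝ) < 2 ^ lam := by positivity
    rw [div_le_iff₀ (by linarith)]
    nlinarith
  linarith

end HaarPRU

end

/-! ### Insecurity against adaptive and non-adaptive adversaries -/

theorem mainTheorem4 (n ℓ : ℕ → ℕ)
    (hn : (fun lam : ℕ => Real.log (lam : ℝ)) =o[Filter.atTop] fun lam : ℕ => (n lam : ℝ))
    (hℓ : (fun lam : ℕ => (lam : ℝ) / Real.log (lam : ℝ)) =o[Filter.atTop]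
      fun lam : ℕ => (ℓ lam : ℝ))
    (G : HaarPRU.OracleConstruction n)
    (hG : ∀ (lam : ℕ) (k : HaarPRU.Qubits lam), ∃ A B : HaarPRU.UnitaryOp (n lam),
      ∀ U : HaarPRU.UnitaryOp (n lam), G lam k U = B * U * A) :
    ¬ HaarPRU.IsQuerySecurePRU n ℓ G ∧ ¬ HaarPRU.IsNonadaptivelyQuerySecurePRU n ℓ G := by
  obtain ⟨𝒜, hc, hh, hadv⟩ := HaarPRU.exists_nonadaptive_adversaries n ℓ hn hℓ G hG
  have hpoly : ∀ lam : ℕ, lam ^ 3 + 1 ≤ (Polynomial.X ^ 3 + 1 : Polynomial ℕ).eval lam := by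
    intro lam; simp
  refine ⟨fun hsec => ?_, fun hsec => ?_⟩
  -- The `+ 1` in the number of common queries guarantees at least one query, as the simulation
  -- requires, even when `lam = 0`.
  · choose ℬ h1 h2 h3 using fun lam =>
      HaarPRU.exists_adaptive_simulation (𝒜 lam) (by rw [hh]; omega)
    obtain ⟨ε, hε, hle⟩ := hsec ℬ (fun lam => (h1 lam).trans_le (hc lam))
      ⟨_, fun lam => ((h2 lam).trans (hh lam)).trans_le (hpoly lam)⟩
    refine HaarPRU.not_negligible_of_eventually_le (c := 1 / 4) (by norm_num) ?_ hε
    filter_upwards [hadv] with lam h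
    rw [← h3 lam] at h
    exact h.trans (hle lam)
  · obtain ⟨ε, hε, hle⟩ := hsec 𝒜 hc ⟨_, fun lam => (hh lam).trans_le (hpoly lam)⟩
    refine HaarPRU.not_negligible_of_eventually_le (c := 1 / 4) (by norm_num) ?_ hε
    filter_upwards [hadv] with lam h
    exact h.trans (hle lam)
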